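/- Let $d\ge 2$ and $e\ge 0$ be integers. For $j\ge 0$ let $Q_j$ be the Gegenbauer polynomial of degree $j$ for the sphere $S^{d-1}$: the polynomials $Q_j$, $\deg Q_j=j$, are orthogonal on $[-1,1]$ with respect to the weight $(1-s^2)^{(d-3)/2}$ and normalized so that $Q_j(1)=\dim \mathrm{Harm}_j(\mathbb R^d)$, where $\mathrm{Harm}_j(\mathbb R^d)$ is the space of real homogeneous harmonic polynomials of degree $j$ in $d$ variables. Let $X\subset\mathbb R^d\setminus\{0\}$ be finite and $w:X\to\mathbb R_{>0}$. For $x\neq 0$ put $x'=x/\|x\|$. For an integer $t\ge 0$, the pair $(X,w)$ is called a strong Euclidean $t$-design if $$\sum_{x,y\in X} w(x)w(y)\,(\|x\|\,\|y\|)^i\,Q_j(x'\cdot y')=0\qquad\text{for all } 0\le i\le t,\ 1\le j\le t.$$ It is called antipodal if $X=-X$ and $w(x)=w(-x)$ for all $x\in X$. Theorem. Let $(X,w)$ be a strong Euclidean $t$-design on $p$ concentric spheres, that is, $p=|\{\|x\| : x\in X\}|$, and assume $p\ge e+1$. (1) If $t=2e$, then $$|X|\ \ge\ (e+1)\left\{\binom{d+e-1}{e}+\binom{d+e-2}{e-1}\right\}.$$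 (2) If $(X,w)$ is antipodal and $t=2e+1$, then $$|X|\ \ge\ 2(e+1)\binom{d+e-1}{e}.$$ Here $\binom{n}{-1}=0$, which is used in (1) for $e=0$. -/

import Mathlib

open Polynomial

noncomputable section

/-- The Laplacian `∑ i, ∂² / ∂ xᵢ²` on real polynomials in `d` variables. -/
def polyLaplacian (d : ℕ) : MvPolynomial (Fin d) ℝ →ₗ[ℝ] MvPolynomial (Fin d) ℝ :=
  ∑ i : Fin d,
    (MvPolynomial.pderiv i).toLinearMap ∘ₗ (MvPolynomial.pderiv (R := ℝ) i).toLinearMap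

/-- `Harm_n(ℝ^d)`: homogeneous polynomials of degree `n` in `d` variables with zero Laplacian. -/
def harmonicHomogeneous (d n : ℕ) : Submodule ℝ (MvPolynomial (Fin d) ℝ) :=
  MvPolynomial.homogeneousSubmodule (Fin d) ℝ n ⊓ LinearMap.ker (polyLaplacian d)

/-- The inner product `∫_{-1}^1 f(s) g(s) (1 - s²)^((d-3)/2) ds` (meaningful for `d ≥ 2`). -/
def gegenbauerInner (d : ℕ) (f g : ℝ[X]) : ℝ :=
  ∫ s in (-1 : ℝ)..1, f.eval s * g.eval s * (1 - s ^ 2) ^ (((d : ℝ) - 3) / 2)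

/-- The monic orthogonal polynomials on `[-1, 1]` for the weight `(1 - s²)^((d-3)/2)`, obtained
from `1, X, X², …` by Gram-Schmidt orthogonalization. -/
def monicGegenbauer (d : ℕ) : ℕ → ℝ[X]
  | n => X ^ n - ∑ k : Fin n,
      C (gegenbauerInner d (X ^ n) (monicGegenbauer d k) /
          gegenbauerInner d (monicGegenbauer d k) (monicGegenbauer d k)) * monicGegenbauer d k

/-- The Gegenbauer polynomial `Q_n` of degree `n` for the sphere `S^{d-1}`: the orthogonal
polynomial of degree `n` normalized by `Q_n(1) = dim Harm_n(ℝ^d)`. -/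
def gegenbauer (d n : ℕ) : ℝ[X] :=
  C ((Module.finrank ℝ (harmonicHomogeneous d n) : ℝ) / (monicGegenbauer d n).eval 1) *
    monicGegenbauer d n

/-- The radial projection `x' = x / ‖x‖` to the unit sphere. -/
def unitDir {d : ℕ} (x : EuclideanSpace ℝ (Fin d)) : EuclideanSpace ℝ (Fin d) := ‖x‖⁻¹ • x

/-- `(X, w)` is a strong Euclidean `t`-design: `X` is a finite set of nonzero points of `ℝ^d`,
`w` is a positive weight function on `X` (its values off `X` play no role), and
`∑_{x, y ∈ X} w(x) w(y) (‖x‖ ‖y‖)^i Q_j(x' · y') = 0` for `0 ≤ i ≤ t` and `1 ≤ j ≤ t`. -/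
structure IsStrongEuclideanDesign {d : ℕ} (t : ℕ) (X : Finset (EuclideanSpace ℝ (Fin d)))
    (w : EuclideanSpace ℝ (Fin d) → ℝ) : Prop where
  zero_notMem : 0 ∉ X
  weight_pos : ∀ x ∈ X, 0 < w x
  sum_eq_zero : ∀ i j : ℕ, i ≤ t → 1 ≤ j → j ≤ t →
    ∑ x ∈ X, ∑ y ∈ X, w x * w y * (‖x‖ * ‖y‖) ^ i *
      (gegenbauer d j).eval (inner ℝ (unitDir x) (unitDir y)) = 0

/-- `(X, w)` is antipodal: `X = -X` and `w(x) = w(-x)` on `X`. -/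
def IsAntipodal {d : ℕ} (X : Finset (EuclideanSpace ℝ (Fin d)))
    (w : EuclideanSpace ℝ (Fin d) → ℝ) : Prop :=
  (∀ x, x ∈ X ↔ -x ∈ X) ∧ ∀ x ∈ X, w x = w (-x)

/-- The set `{‖x‖ : x ∈ X}` of radii of the origin-centered spheres that meet `X`. -/
def radii {d : ℕ} (X : Finset (EuclideanSpace ℝ (Fin d))) : Finset ℝ := X.image (fun x => ‖x‖)

end

/-!
A strong Euclidean design integrates exactly, in the direction `x'`, every function
`‖x‖ⁱ q(x')` with `i ≤ t` and `q` a homogeneous polynomial of degree at most `t`: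
`∑ w(x) ‖x‖ⁱ q(x') = (∑ w(x) ‖x‖ⁱ) ⟨q⟩`, where `⟨q⟩` is the mean of `q` over the unit sphere
(`IsStrongEuclideanDesign.sum_eval`). Given this, take the test functions
`F(x) = ∑_{i ≤ e} ‖x‖ⁱ fᵢ(x')` with `fᵢ` in the sum of the spaces of homogeneous polynomials of
degrees `e` and `e - 1`. If `F` vanishes on `X`, then `0 = ∑ w F²` is the weighted sum over `X` of
the means of `F²` over the spheres through the points of `X`. So `F` vanishes on at least `e + 1`
concentric spheres, and as its degree in the radius is at most `e`, all `fᵢ` vanish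
(`IsStrongEuclideanDesign.eq_zero_of_sum_sq_nonpos`). Hence restriction to `X` is injective on a
space of dimension `(e + 1) {C(d+e-1, e) + C(d+e-2, e-1)}`. In the antipodal case homogeneous `fᵢ`
of degree `e` alone are used; then `F` is even or odd, and its restriction to one half of `X` is
already injective.

The exactness is proved without spherical harmonics or integration over the sphere. The mean over
the sphere is realized as `𝔼 q / radialMoment d k` for `q` homogeneous of degree `k`, with `𝔼` the
expectation at a standard Gaussian vector; integration by parts gives all the values needed. The
normalized moments of the Gegenbauer weight obey the same recursion as the means of `(u ⬝ x)^k` for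
a unit vector `u` (`gegenbauerIntegral_X_pow`). As `Q_j`, `j ≥ 1`, is orthogonal to the constants
and a nonzero multiple of a monic polynomial of degree `j`, the design condition yields
`∑ w(x) w(y) (‖x‖ ‖y‖)ⁱ (x' ⬝ y')^k = (∑ w(x) ‖x‖ⁱ)² ⟨(u ⬝ x)^k⟩`
(`sum_inner_pow_of_gegenbauer`). Expanding `(x' ⬝ y')^k` into monomials, this says that a sum of
squares vanishes, whose terms are the defects of exactness on the monomials of degree `k`
(`sum_eval_of_gegenbauer`).
-/

/-! ### Gaussian expectation of polynomials -/

section GaussianExpectation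

open MeasureTheory ProbabilityTheory

/-- The `n`-th moment of the standard Gaussian distribution on `ℝ`. -/
noncomputable def gaussianMoment (n : ℕ) : ℝ := ∫ x, x ^ n ∂gaussianReal 0 1

theorem integrable_pow_gaussianReal (n : ℕ) :
    Integrable (fun x : ℝ => x ^ n) (gaussianReal 0 1) := by
  have h := (memLp_id_gaussianReal (μ := 0) (v := 1) n).integrable_norm_pow'
  exact h.mono' (by fun_prop) (Filter.Eventually.of_forall fun x => (norm_pow x n).le)

@[simp]
theorem gaussianMoment_zero : gaussianMoment 0 = 1 := by
  simp [gaussianMoment]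

@[simp]
theorem gaussianMoment_one : gaussianMoment 1 = 0 := by
  simp [gaussianMoment]

theorem gaussianMoment_add_two (n : ℕ) :
    gaussianMoment (n + 2) = (n + 1) * gaussianMoment n := by
  have hint (k : ℕ) : Integrable (fun x : ℝ => gaussianPDFReal 0 1 x * x ^ k) := by
    have h := integrable_pow_gaussianReal k
    rw [gaussianReal_of_var_ne_zero _ one_ne_zero,
      integrable_withDensity_iff_integrable_smul' (measurable_gaussianPDF 0 1)
        (Filter.Eventually.of_forall fun _ => gaussianPDF_lt_top)] at h
    simpa using h
  have hval (k : ℕ) : gaussianMoment k = ∫ x : ℝ, gaussianPDFReal 0 1 x * x ^ k := by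
    rw [gaussianMoment, integral_gaussianReal_eq_integral_smul one_ne_zero]
    simp
  have hpdf (x : ℝ) : HasDerivAt (gaussianPDFReal 0 1) (-x * gaussianPDFReal 0 1 x) x := by
    have h1 : HasDerivAt (fun x : ℝ => -(x - 0) ^ 2 / (2 * ((1 : NNReal) : ℝ))) (-x) x := by
      have := (((hasDerivAt_id' x).sub_const 0).pow 2).neg.div_const (2 * ((1 : NNReal) : ℝ))
      refine this.congr_deriv ?_
      simp
      ring
    have h2 := h1.exp.const_mul (√(2 * Real.pi * ((1 : NNReal) : ℝ)))⁻¹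
    rw [gaussianPDFReal_def]
    refine h2.congr_deriv ?_
    ring
  have hder (x : ℝ) : HasDerivAt (fun x : ℝ => gaussianPDFReal 0 1 x * x ^ (n + 1))
      ((n + 1) * (gaussianPDFReal 0 1 x * x ^ n) - gaussianPDFReal 0 1 x * x ^ (n + 2)) x := by
    refine ((hpdf x).mul (hasDerivAt_pow (n + 1) x)).congr_deriv ?_
    push_cast
    ring_nf
  have h0 := integral_eq_zero_of_hasDerivAt_of_integrable hder
    (((hint n).const_mul _).sub (hint (n + 2))) (hint (n + 1))
  rw [integral_sub ((hint n).const_mul _) (hint (n + 2)), integral_const_mul, ← hval,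
    ← hval] at h0
  linarith

theorem gaussianMoment_odd (n : ℕ) : gaussianMoment (2 * n + 1) = 0 := by
  induction n with
  | zero => simp
  | succ n ih =>
    rw [show 2 * (n + 1) + 1 = (2 * n + 1) + 2 by ring, gaussianMoment_add_two, ih, mul_zero]

theorem gaussianMoment_eq_zero_of_odd {n : ℕ} (hn : Odd n) : gaussianMoment n = 0 := by
  obtain ⟨m, rfl⟩ := hn
  exact gaussianMoment_odd m

variable {d : ℕ}

theorem integrable_eval_gaussian (p : MvPolynomial (Fin d) ℝ) :
    Integrable (fun x : Fin d → ℝ => MvPolynomial.eval x p)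
      (Measure.pi fun _ : Fin d => gaussianReal 0 1) := by
  induction p using MvPolynomial.induction_on' with
  | monomial s a =>
    simp only [MvPolynomial.eval_monomial, Finsupp.prod_fintype _ _ (fun _ => pow_zero _)]
    exact (Integrable.fintype_prod (f := fun i x => x ^ s i)
      fun i => integrable_pow_gaussianReal (s i)).const_mul a
  | add p q hp hq =>
    simp only [map_add]
    exact hp.add hq

/-- The expectation of a polynomial evaluated at a standard Gaussian vector in `ℝ^d`. -/
noncomputable def gaussianExpectation (d : ℕ) : MvPolynomial (Fin d) ℝ →ₗ[ℝ] ℝ where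
  toFun p := ∫ x, MvPolynomial.eval x p ∂(Measure.pi fun _ : Fin d => gaussianReal 0 1)
  map_add' p q := by
    simpa using integral_add (integrable_eval_gaussian p) (integrable_eval_gaussian q)
  map_smul' a p := by
    simp [MvPolynomial.smul_eval, integral_const_mul]

theorem gaussianExpectation_monomial (s : Fin d →₀ ℕ) (a : ℝ) :
    gaussianExpectation d (MvPolynomial.monomial s a) = a * ∏ i, gaussianMoment (s i) := by
  simp only [gaussianExpectation, LinearMap.coe_mk, AddHom.coe_mk, MvPolynomial.eval_monomial,
    Finsupp.prod_fintype _ _ (fun _ => pow_zero _), integral_const_mul]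
  rw [integral_fintype_prod_eq_prod (fun i x => x ^ s i)]
  rfl

@[simp]
theorem gaussianExpectation_one : gaussianExpectation d 1 = 1 := by
  simpa using gaussianExpectation_monomial (0 : Fin d →₀ ℕ) 1

theorem gaussianExpectation_C_mul (a : ℝ) (p : MvPolynomial (Fin d) ℝ) :
    gaussianExpectation d (MvPolynomial.C a * p) = a * gaussianExpectation d p := by
  rw [← MvPolynomial.smul_eq_C_mul, map_smul, smul_eq_mul]

theorem gaussianExpectation_eq_zero_of_odd {n : ℕ} (hn : Odd n) {p : MvPolynomial (Fin d) ℝ}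
    (hp : p.IsHomogeneous n) : gaussianExpectation d p = 0 := by
  rw [p.as_sum, map_sum]
  refine Finset.sum_eq_zero fun s hs => ?_
  have hdeg : ∑ i, s i = n := by
    have := hp (MvPolynomial.mem_support_iff.mp hs)
    rw [Finsupp.weight_apply, Finsupp.sum_fintype _ _ (by simp)] at this
    simpa using this
  obtain ⟨i, hi⟩ : ∃ i, Odd (s i) := by
    by_contra! h
    simp only [Nat.not_odd_iff_even] at h
    exact Nat.not_even_iff_odd.mpr hn (hdeg ▸ Finset.even_sum _ fun i _ => h i)
  rw [gaussianExpectation_monomial,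
    Finset.prod_eq_zero (Finset.mem_univ i) (gaussianMoment_eq_zero_of_odd hi), mul_zero]

/-- Gaussian integration by parts (Stein's identity). -/
theorem gaussianExpectation_X_mul (i : Fin d) (p : MvPolynomial (Fin d) ℝ) :
    gaussianExpectation d (MvPolynomial.X i * p) =
      gaussianExpectation d (MvPolynomial.pderiv i p) := by
  induction p using MvPolynomial.induction_on' with
  | add p q hp hq => simp only [mul_add, map_add, hp, hq]
  | monomial s a =>
    have hsplit (u : Fin d →₀ ℕ) : ∏ j, gaussianMoment (u j) =
        gaussianMoment (u i) * ∏ j ∈ Finset.univ.erase i, gaussianMoment (u j) :=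
      (Finset.mul_prod_erase _ _ (Finset.mem_univ i)).symm
    have h1 : ∏ j ∈ Finset.univ.erase i, gaussianMoment ((Finsupp.single i 1 + s : Fin d →₀ ℕ) j) =
        ∏ j ∈ Finset.univ.erase i, gaussianMoment (s j) :=
      Finset.prod_congr rfl fun j hj => by
        simp [Finsupp.single_eq_of_ne (Finset.ne_of_mem_erase hj)]
    have h2 : ∏ j ∈ Finset.univ.erase i, gaussianMoment ((s - Finsupp.single i 1 : Fin d →₀ ℕ) j) =
        ∏ j ∈ Finset.univ.erase i, gaussianMoment (s j) :=
      Finset.prod_congr rfl fun j hj => by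
        simp [Finsupp.single_eq_of_ne (Finset.ne_of_mem_erase hj)]
    rw [MvPolynomial.X, MvPolynomial.monomial_mul, MvPolynomial.pderiv_monomial,
      gaussianExpectation_monomial, gaussianExpectation_monomial, hsplit, h1,
      hsplit (s - Finsupp.single i 1), h2]
    have h3 : gaussianMoment (1 + s i) = s i * gaussianMoment (s i - 1) := by
      rcases s i with _ | n
      · simp
      · rw [show 1 + (n + 1) = n + 2 by ring, gaussianMoment_add_two]
        simp
    simp only [Finsupp.add_apply, Finsupp.tsub_apply, Finsupp.single_eq_same, h3]
    ring

theorem eq_zero_of_gaussianExpectation_mul_self {p : MvPolynomial (Fin d) ℝ}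
    (hp : gaussianExpectation d (p * p) = 0) : p = 0 := by
  have : (gaussianReal 0 1).IsOpenPosMeasure :=
    (gaussianReal_absolutelyContinuous' 0 one_ne_zero).isOpenPosMeasure
  have hcont : Continuous fun x : Fin d → ℝ => MvPolynomial.eval x (p * p) :=
    MvPolynomial.continuous_eval _
  have hae := (integral_eq_zero_iff_of_nonneg (fun x => by
    simpa using mul_self_nonneg (MvPolynomial.eval x p)) (integrable_eval_gaussian (p * p))).mp hp
  have hzero := Measure.eq_of_ae_eq hae hcont continuous_const
  refine MvPolynomial.funext fun x => ?_
  simpa using congrFun hzero x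

/-- The linear form `∑ aᵢ Xᵢ`. -/
noncomputable def linearForm (a : Fin d → ℝ) : MvPolynomial (Fin d) ℝ :=
  ∑ i, MvPolynomial.C (a i) * MvPolynomial.X i

/-- The quadratic form `∑ Xᵢ²`. -/
noncomputable def normSqPoly (d : ℕ) : MvPolynomial (Fin d) ℝ :=
  ∑ i, MvPolynomial.X i ^ 2

/-- For even `k`, the expectation of `‖x‖^k` for a standard Gaussian vector `x` in `ℝ^d`. The
values at odd `k` are not such expectations; they only have to be nonzero and to satisfy the same
recursion, since they normalize odd Gaussian moments, which vanish. -/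
noncomputable def radialMoment (d : ℕ) : ℕ → ℝ
  | 0 => 1
  | 1 => 1
  | k + 2 => (d + k) * radialMoment d k

theorem radialMoment_pos (hd : 0 < d) (k : ℕ) : 0 < radialMoment d k := by
  induction k using Nat.twoStepInduction with
  | zero => simp [radialMoment]
  | one => simp [radialMoment]
  | more k ih _ => rw [radialMoment]; positivity

theorem gaussianExpectation_linearForm_pow_add_two (a : Fin d → ℝ) (k : ℕ) :
    gaussianExpectation d (linearForm a ^ (k + 2)) =
      (k + 1) * (∑ i, a i ^ 2) * gaussianExpectation d (linearForm a ^ k) := by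
  have hder (i : Fin d) : MvPolynomial.pderiv i (linearForm a) = MvPolynomial.C (a i) := by
    simp [linearForm, MvPolynomial.pderiv_X, Pi.single_apply]
  rw [show linearForm a ^ (k + 2) = linearForm a * linearForm a ^ (k + 1) by ring]
  nth_rewrite 1 [linearForm]
  rw [Finset.sum_mul, map_sum, Finset.mul_sum, Finset.sum_mul]
  refine Finset.sum_congr rfl fun i _ => ?_
  rw [mul_assoc, gaussianExpectation_C_mul, gaussianExpectation_X_mul, MvPolynomial.pderiv_pow,
    hder, show ((k + 1 : ℕ) : MvPolynomial (Fin d) ℝ) = MvPolynomial.C ((k : ℝ) + 1) by simp,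
    Nat.add_sub_cancel, show MvPolynomial.C ((k : ℝ) + 1) * linearForm a ^ k * MvPolynomial.C (a i)
      = MvPolynomial.C (((k : ℝ) + 1) * a i) * linearForm a ^ k by rw [map_mul]; ring,
    gaussianExpectation_C_mul]
  ring

theorem linearForm_isHomogeneous (a : Fin d → ℝ) : (linearForm a).IsHomogeneous 1 :=
  MvPolynomial.IsHomogeneous.sum _ _ _ fun i _ => by
    simpa using (MvPolynomial.isHomogeneous_C (Fin d) (a i)).mul
      (MvPolynomial.isHomogeneous_X ℝ i)

theorem gaussianExpectation_linearForm_pow_even (a : Fin d → ℝ) (m : ℕ) :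
    gaussianExpectation d (linearForm a ^ (2 * m)) =
      (∑ i, a i ^ 2) ^ m * gaussianMoment (2 * m) := by
  induction m with
  | zero => simp
  | succ m ih =>
    rw [show 2 * (m + 1) = 2 * m + 2 by ring, gaussianExpectation_linearForm_pow_add_two, ih,
      gaussianMoment_add_two]
    ring

/-- The one-dimensional marginals of a standard Gaussian vector are standard Gaussian. -/
theorem gaussianExpectation_linearForm_pow {a : Fin d → ℝ} (ha : ∑ i, a i ^ 2 = 1) (k : ℕ) :
    gaussianExpectation d (linearForm a ^ k) = gaussianMoment k := by
  rcases Nat.even_or_odd' k with ⟨m, rfl | rfl⟩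
  · rw [gaussianExpectation_linearForm_pow_even, ha, one_pow, one_mul]
  · rw [gaussianMoment_odd]
    exact gaussianExpectation_eq_zero_of_odd ⟨m, rfl⟩
      (by simpa using (linearForm_isHomogeneous a).pow (2 * m + 1))

theorem gaussianExpectation_normSqPoly_pow (m : ℕ) :
    gaussianExpectation d (normSqPoly d ^ m) = radialMoment d (2 * m) := by
  induction m with
  | zero => simp [radialMoment]
  | succ m ih =>
    have hder (i : Fin d) : MvPolynomial.pderiv i (normSqPoly d) = 2 * MvPolynomial.X i := by
      simp [normSqPoly, MvPolynomial.pderiv_X, Pi.single_apply]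
    have hstep (i : Fin d) : gaussianExpectation d (MvPolynomial.X i ^ 2 * normSqPoly d ^ m) =
        gaussianExpectation d (normSqPoly d ^ m) + (2 * m) *
          gaussianExpectation d (MvPolynomial.X i ^ 2 * normSqPoly d ^ (m - 1)) := by
      rw [pow_two, mul_assoc, gaussianExpectation_X_mul, MvPolynomial.pderiv_mul,
        MvPolynomial.pderiv_X_self, MvPolynomial.pderiv_pow, hder, one_mul, map_add,
        ← gaussianExpectation_C_mul]
      congr 2
      simp only [map_mul, map_natCast, map_ofNat]
      ring
    rw [pow_succ', show normSqPoly d * normSqPoly d ^ m =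
        ∑ i, MvPolynomial.X i ^ 2 * normSqPoly d ^ m by rw [← Finset.sum_mul, normSqPoly],
      map_sum, Finset.sum_congr rfl fun i _ => hstep i, Finset.sum_add_distrib,
      Finset.sum_const, Finset.card_univ,
      Fintype.card_fin, ← Finset.mul_sum, ← map_sum, ← Finset.sum_mul, ← normSqPoly, ih,
      show 2 * (m + 1) = 2 * m + 2 by ring, radialMoment]
    rcases m with _ | m
    · simp
    · rw [Nat.add_sub_cancel, ← pow_succ', ih]
      simp
      ring

end GaussianExpectation

/-! ### Orthogonality of the Gegenbauer polynomials -/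

section Gegenbauer

open MeasureTheory

variable {d : ℕ}

theorem one_sub_sq_pos {s : ℝ} (hs : s ∈ Set.Ioo (-1 : ℝ) 1) : 0 < 1 - s ^ 2 := by
  nlinarith [hs.1, hs.2]

theorem intervalIntegrable_gegenbauerWeight (hd : 2 ≤ d) :
    IntervalIntegrable (fun s : ℝ => (1 - s ^ 2) ^ (((d : ℝ) - 3) / 2)) volume (-1) 1 := by
  have hdom : IntervalIntegrable (fun s : ℝ => 1 / √(1 - s ^ 2)) volume (-1) 1 :=
    intervalIntegral.intervalIntegrable_deriv_of_nonneg Real.continuous_arcsin.continuousOn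
      (fun x hx => by
        simp only [neg_le_self_iff, zero_le_one, inf_of_le_left, sup_of_le_right] at hx
        exact Real.hasDerivAt_arcsin (by linarith [hx.1]) (by linarith [hx.2]))
      (fun x _ => by positivity)
  rw [intervalIntegrable_iff_integrableOn_Ioo_of_le (by norm_num)] at hdom ⊢
  refine hdom.mono' (Measurable.pow_const (by fun_prop) _).aestronglyMeasurable ?_
  filter_upwards [ae_restrict_mem measurableSet_Ioo] with s hs
  have h := one_sub_sq_pos hs
  have hd' : (2 : ℝ) ≤ d := by exact_mod_cast hd
  rw [Real.norm_of_nonneg (by positivity), Real.sqrt_eq_rpow, one_div, ← Real.rpow_neg h.le]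
  exact Real.rpow_le_rpow_of_exponent_ge h (by nlinarith [sq_nonneg s]) (by linarith)

theorem intervalIntegrable_gegenbauer (hd : 2 ≤ d) (p : ℝ[X]) :
    IntervalIntegrable (fun s : ℝ => p.eval s * (1 - s ^ 2) ^ (((d : ℝ) - 3) / 2))
      volume (-1) 1 :=
  (intervalIntegrable_gegenbauerWeight hd).continuousOn_mul p.continuous.continuousOn

/-- Integration of polynomials against the Gegenbauer weight. -/
noncomputable def gegenbauerIntegral (hd : 2 ≤ d) : ℝ[X] →ₗ[ℝ] ℝ where
  toFun p := ∫ s in (-1 : ℝ)..1, p.eval s * (1 - s ^ 2) ^ (((d : ℝ) - 3) / 2)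
  map_add' p q := by
    simpa [add_mul] using intervalIntegral.integral_add (intervalIntegrable_gegenbauer hd p)
      (intervalIntegrable_gegenbauer hd q)
  map_smul' a p := by
    simp [mul_assoc]

theorem gegenbauerInner_eq (hd : 2 ≤ d) (p q : ℝ[X]) :
    gegenbauerInner d p q = gegenbauerIntegral hd (p * q) := by
  simp [gegenbauerInner, gegenbauerIntegral]

theorem gegenbauerIntegral_C_mul (hd : 2 ≤ d) (a : ℝ) (p : ℝ[X]) :
    gegenbauerIntegral hd (C a * p) = a * gegenbauerIntegral hd p := by
  rw [← smul_eq_C_mul, map_smul, smul_eq_mul]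

theorem gegenbauerIntegral_pos (hd : 2 ≤ d) {p : ℝ[X]} (hp : p ≠ 0)
    (hpos : ∀ s ∈ Set.Ioo (-1 : ℝ) 1, 0 ≤ p.eval s) : 0 < gegenbauerIntegral hd p := by
  have hae : 0 ≤ᵐ[volume.restrict (Set.uIoc (-1 : ℝ) 1)]
      fun s : ℝ => p.eval s * (1 - s ^ 2) ^ (((d : ℝ) - 3) / 2) := by
    rw [Set.uIoc_of_le (by norm_num), ← restrict_Ioo_eq_restrict_Ioc]
    filter_upwards [ae_restrict_mem measurableSet_Ioo] with s hs
    exact mul_nonneg (hpos s hs) (Real.rpow_nonneg (one_sub_sq_pos hs).le _)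
  refine (intervalIntegral.integral_pos_iff_support_of_nonneg_ae' hae
    (intervalIntegrable_gegenbauer hd p)).mpr ⟨by norm_num, ?_⟩
  have hsub : Set.Ioo (-1 : ℝ) 1 \ (p.roots.toFinset : Set ℝ) ⊆
      Function.support (fun s : ℝ => p.eval s * (1 - s ^ 2) ^ (((d : ℝ) - 3) / 2)) ∩
        Set.Ioc (-1) 1 := by
    rintro s ⟨hs, hr⟩
    refine ⟨mul_ne_zero ?_ (Real.rpow_pos_of_pos (one_sub_sq_pos hs) _).ne',
      Set.Ioo_subset_Ioc_self hs⟩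
    simpa [hp] using hr
  refine lt_of_lt_of_le ?_ (measure_mono hsub)
  rw [measure_sdiff_null (Set.Finite.measure_zero (Finset.finite_toSet _) _), Real.volume_Ioo]
  norm_num

theorem gegenbauerIntegral_X_pow_add_two (hd : 2 ≤ d) (k : ℕ) :
    (d + k) * gegenbauerIntegral hd (X ^ (k + 2)) =
      (k + 1) * gegenbauerIntegral hd (X ^ k) := by
  set a : ℝ := ((d : ℝ) - 3) / 2 with ha
  have hd' : (2 : ℝ) ≤ d := by exact_mod_cast hd
  have ha1 : 0 < a + 1 := by rw [ha]; linarith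
  have hcont : ContinuousOn (fun s : ℝ => s ^ (k + 1) * (1 - s ^ 2) ^ (a + 1))
      (Set.Icc (-1) 1) :=
    (Continuous.mul (by fun_prop)
      (Continuous.rpow_const (by fun_prop) fun _ => Or.inr ha1.le)).continuousOn
  have hder : ∀ s ∈ Set.Ioo (-1 : ℝ) 1,
      HasDerivAt (fun s : ℝ => s ^ (k + 1) * (1 - s ^ 2) ^ (a + 1))
        ((C ((k : ℝ) + 1) * X ^ k - C ((d : ℝ) + k) * X ^ (k + 2) : ℝ[X]).eval s *
          (1 - s ^ 2) ^ a) s := by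
    intro s hs
    have h := one_sub_sq_pos hs
    have h1 : HasDerivAt (fun s : ℝ => 1 - s ^ 2) (-(2 * s)) s := by
      simpa using (hasDerivAt_pow 2 s).const_sub 1
    refine ((hasDerivAt_pow (k + 1) s).mul
      (h1.rpow_const (p := a + 1) (Or.inl h.ne'))).congr_deriv ?_
    rw [add_sub_cancel_right, Real.rpow_add_one h.ne', ha]
    simp
    ring
  have h := intervalIntegral.integral_eq_sub_of_hasDerivAt_of_le (by norm_num) hcont hder
    (intervalIntegrable_gegenbauer hd _)
  change gegenbauerIntegral hd _ = _ at h
  rw [map_sub, gegenbauerIntegral_C_mul, gegenbauerIntegral_C_mul] at h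
  simp only [one_pow, even_two, Even.neg_pow, sub_self, Real.zero_rpow ha1.ne', mul_zero] at h
  linarith

theorem gegenbauerIntegral_X (hd : 2 ≤ d) : gegenbauerIntegral hd X = 0 := by
  have h := intervalIntegral.integral_comp_neg (a := -1) (b := 1)
    (fun s : ℝ => (X : ℝ[X]).eval s * (1 - s ^ 2) ^ (((d : ℝ) - 3) / 2))
  simp only [eval_X, even_two, Even.neg_pow, neg_mul, neg_neg, intervalIntegral.integral_neg] at h
  simp only [gegenbauerIntegral, LinearMap.coe_mk, AddHom.coe_mk, eval_X]
  linarith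

theorem gegenbauerIntegral_one_pos (hd : 2 ≤ d) : 0 < gegenbauerIntegral hd 1 :=
  gegenbauerIntegral_pos hd one_ne_zero fun s _ => by simp

/-- The moments of the Gegenbauer weight, normalized to total mass one, are the quotients of the
moments of a one-dimensional Gaussian and of the norm of a `d`-dimensional one: `1 - s²` to the
power `(d-3)/2` is the density of a coordinate of a uniformly distributed point on the sphere. -/
theorem gegenbauerIntegral_X_pow (hd : 2 ≤ d) (k : ℕ) :
    gegenbauerIntegral hd (X ^ k) * radialMoment d k =
      gaussianMoment k * gegenbauerIntegral hd 1 := by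
  induction k using Nat.twoStepInduction with
  | zero => simp [radialMoment]
  | one => simp [gegenbauerIntegral_X]
  | more k ih _ =>
    have h := gegenbauerIntegral_X_pow_add_two hd k
    rw [radialMoment, gaussianMoment_add_two]
    linear_combination radialMoment d k * h + ((k : ℝ) + 1) * ih

theorem monicGegenbauer_monic (d n : ℕ) :
    (monicGegenbauer d n).Monic ∧ (monicGegenbauer d n).natDegree = n := by
  induction n using Nat.strong_induction_on with
  | _ n ih =>
    have hlt : (∑ k : Fin n, C (gegenbauerInner d (X ^ n) (monicGegenbauer d k) /
        gegenbauerInner d (monicGegenbauer d k) (monicGegenbauer d k)) *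
          monicGegenbauer d k).degree < n := by
      refine (degree_sum_le _ _).trans_lt ((Finset.sup_lt_iff (WithBot.bot_lt_coe n)).mpr
        fun k _ => ?_)
      refine degree_le_natDegree.trans_lt ?_
      exact Nat.cast_lt.mpr ((natDegree_C_mul_le _ _).trans_lt ((ih k k.2).2.trans_lt k.2))
    rw [monicGegenbauer]
    have hm := monic_X_pow_sub (n := n) hlt
    exact ⟨hm, by
      rw [← degree_X_pow (R := ℝ) n] at hlt
      have := degree_sub_eq_left_of_degree_lt hlt
      rw [degree_X_pow] at this
      exact natDegree_eq_of_degree_eq_some this⟩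

theorem gegenbauerIntegral_mul_self_pos (hd : 2 ≤ d) {p : ℝ[X]} (hp : p ≠ 0) :
    0 < gegenbauerIntegral hd (p * p) :=
  gegenbauerIntegral_pos hd (mul_ne_zero hp hp) fun s _ => by
    simpa using mul_self_nonneg (p.eval s)

theorem gegenbauerIntegral_monicGegenbauer_mul (hd : 2 ≤ d) {n k : ℕ} (hk : k < n) :
    gegenbauerIntegral hd (monicGegenbauer d n * monicGegenbauer d k) = 0 := by
  induction n using Nat.strong_induction_on generalizing k with
  | _ n ih =>
    rw [monicGegenbauer, sub_mul, Finset.sum_mul, map_sub, map_sum,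
      Finset.sum_eq_single (⟨k, hk⟩ : Fin n)]
    · have := (gegenbauerIntegral_mul_self_pos hd (monicGegenbauer_monic d k).1.ne_zero).ne'
      rw [mul_assoc, gegenbauerIntegral_C_mul, gegenbauerInner_eq hd, gegenbauerInner_eq hd]
      field_simp
      ring
    · intro j _ hj
      rw [mul_assoc, gegenbauerIntegral_C_mul]
      rcases lt_or_gt_of_ne (fun h => hj (Fin.ext h) : (j : ℕ) ≠ k) with h | h
      · rw [mul_comm (monicGegenbauer d j), ih k hk h, mul_zero]
      · rw [ih j j.2 h, mul_zero]
    · simp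

theorem X_pow_eq_monicGegenbauer_add (d n : ℕ) :
    ∃ c : Fin n → ℝ, (X ^ n : ℝ[X]) =
      monicGegenbauer d n + ∑ k : Fin n, C (c k) * monicGegenbauer d k := by
  refine ⟨fun k => gegenbauerInner d (X ^ n) (monicGegenbauer d k) /
    gegenbauerInner d (monicGegenbauer d k) (monicGegenbauer d k), ?_⟩
  rw [monicGegenbauer, sub_add_cancel]

theorem gegenbauerIntegral_monicGegenbauer_mul_of_natDegree_lt (hd : 2 ≤ d) {n : ℕ} {q : ℝ[X]}
    (hq : q.natDegree < n) : gegenbauerIntegral hd (monicGegenbauer d n * q) = 0 := by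
  have hX (k : ℕ) (hk : k < n) : gegenbauerIntegral hd (monicGegenbauer d n * X ^ k) = 0 := by
    obtain ⟨c, hc⟩ := X_pow_eq_monicGegenbauer_add d k
    rw [hc, mul_add, Finset.mul_sum, map_add, map_sum,
      gegenbauerIntegral_monicGegenbauer_mul hd hk, zero_add]
    refine Finset.sum_eq_zero fun j _ => ?_
    rw [mul_left_comm, gegenbauerIntegral_C_mul,
      gegenbauerIntegral_monicGegenbauer_mul hd (j.2.trans hk), mul_zero]
  rw [q.as_sum_range_C_mul_X_pow, Finset.mul_sum, map_sum]
  refine Finset.sum_eq_zero fun k hk => ?_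
  rw [mul_left_comm, gegenbauerIntegral_C_mul,
    hX k ((Nat.lt_succ_iff.mp (Finset.mem_range.mp hk)).trans_lt hq), mul_zero]

/-- An orthogonal polynomial does not vanish at an endpoint of the interval. -/
theorem monicGegenbauer_eval_one_ne_zero (hd : 2 ≤ d) (n : ℕ) :
    (monicGegenbauer d n).eval 1 ≠ 0 := by
  intro h
  obtain ⟨q, hq⟩ := dvd_iff_isRoot.mpr h
  have hM := monicGegenbauer_monic d n
  have hq0 : q ≠ 0 := by
    rintro rfl
    exact hM.1.ne_zero (by rw [hq, mul_zero])
  have hdeg : q.natDegree < n := by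
    have := hM.2
    rw [hq, natDegree_mul (X_sub_C_ne_zero 1) hq0, natDegree_X_sub_C] at this
    omega
  -- `(1 - X) q²` is nonnegative on the interval, but equals `-(monicGegenbauer d n) q`.
  have hpos : 0 < gegenbauerIntegral hd (-(monicGegenbauer d n * q)) := by
    refine gegenbauerIntegral_pos hd
      (neg_ne_zero.mpr (mul_ne_zero hM.1.ne_zero hq0)) fun s hs => ?_
    rw [hq]
    simp only [map_one, eval_neg, eval_mul, eval_sub, eval_X, eval_one]
    nlinarith [mul_nonneg (sub_nonneg.mpr hs.2.le) (mul_self_nonneg (q.eval s))]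
  rw [map_neg, gegenbauerIntegral_monicGegenbauer_mul_of_natDegree_lt hd hdeg] at hpos
  simp at hpos

end Gegenbauer

/-! ### Harmonic polynomials and dimensions -/

section Harmonic

open MvPolynomial

variable {d : ℕ}

theorem homogeneousSubmodule_finite_finrank (d n : ℕ) :
    Module.Finite ℝ (homogeneousSubmodule (Fin d) ℝ n) ∧
      Module.finrank ℝ (homogeneousSubmodule (Fin d) ℝ n) = (d + n - 1).choose n := by
  have hset : {s : Fin d →₀ ℕ | s.degree = n} =
      (Finset.univ.finsuppAntidiag n : Finset (Fin d →₀ ℕ)) := by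
    ext s
    simp [Finset.mem_finsuppAntidiag, Finsupp.degree_eq_sum]
  rw [homogeneousSubmodule_eq_finsupp_supported, hset]
  let φ := AddMonoidAlgebra.supportedEquivFinsupp (R := ℝ) (S := ℝ)
    ((Finset.univ.finsuppAntidiag n : Finset (Fin d →₀ ℕ)) : Set (Fin d →₀ ℕ))
  refine ⟨Module.Finite.equiv φ.symm, ?_⟩
  rw [φ.finrank_eq, Module.finrank_finsupp_self]
  simp [Finset.card_finsuppAntidiag_nat_eq_choose]

instance (d n : ℕ) : Module.Finite ℝ (homogeneousSubmodule (Fin d) ℝ n) :=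
  (homogeneousSubmodule_finite_finrank d n).1

/-- The real and imaginary parts of `(x + iy)ⁿ`. -/
noncomputable def reImPow (i j : Fin d) : ℕ → MvPolynomial (Fin d) ℝ × MvPolynomial (Fin d) ℝ
  | 0 => (1, 0)
  | n + 1 => (X i * (reImPow i j n).1 - X j * (reImPow i j n).2,
      X i * (reImPow i j n).2 + X j * (reImPow i j n).1)

theorem reImPow_isHomogeneous (i j : Fin d) (n : ℕ) :
    (reImPow i j n).1.IsHomogeneous n ∧ (reImPow i j n).2.IsHomogeneous n := by
  induction n with
  | zero => exact ⟨isHomogeneous_one _ _, isHomogeneous_zero _ _ _⟩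
  | succ n ih =>
    have h (k : Fin d) {p : MvPolynomial (Fin d) ℝ} (hp : p.IsHomogeneous n) :
        (X k * p).IsHomogeneous (n + 1) := add_comm n 1 ▸ (isHomogeneous_X ℝ k).mul hp
    exact ⟨(h i ih.1).sub (h j ih.2), (h i ih.2).add (h j ih.1)⟩

/-- The Cauchy-Riemann equations for `(x + iy)ⁿ`. -/
theorem pderiv_reImPow {i j : Fin d} (hij : i ≠ j) (n : ℕ) :
    pderiv i (reImPow i j n).1 = pderiv j (reImPow i j n).2 ∧
      pderiv j (reImPow i j n).1 = -pderiv i (reImPow i j n).2 := by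
  induction n with
  | zero => simp [reImPow]
  | succ n ih =>
    simp only [reImPow, map_sub, map_add, pderiv_mul, pderiv_X_self, pderiv_X_of_ne hij,
      pderiv_X_of_ne hij.symm, ih.1, ih.2]
    constructor <;> ring

theorem pderiv_reImPow_of_ne {i j k : Fin d} (hi : i ≠ k) (hj : j ≠ k) (n : ℕ) :
    pderiv k (reImPow i j n).1 = 0 ∧ pderiv k (reImPow i j n).2 = 0 := by
  induction n with
  | zero => simp [reImPow]
  | succ n ih =>
    simp [reImPow, pderiv_X_of_ne hi, pderiv_X_of_ne hj, ih.1, ih.2]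

theorem pderiv_pderiv_comm (i j : Fin d) (p : MvPolynomial (Fin d) ℝ) :
    pderiv i (pderiv j p) = pderiv j (pderiv i p) := by
  have h : ⁅pderiv (R := ℝ) i, pderiv (R := ℝ) j⁆ = 0 := by
    refine derivation_ext fun k => ?_
    simp only [Derivation.commutator_apply, pderiv_X, Pi.single_apply]
    split_ifs <;> simp
  have := congrArg (fun D => D p) h
  rwa [Derivation.commutator_apply, Derivation.zero_apply, sub_eq_zero] at this

theorem polyLaplacian_reImPow {i j : Fin d} (hij : i ≠ j) (n : ℕ) :
    polyLaplacian d (reImPow i j n).1 = 0 := by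
  have happ (p : MvPolynomial (Fin d) ℝ) :
      polyLaplacian d p = ∑ k, pderiv k (pderiv k p) := by
    simp [polyLaplacian, LinearMap.sum_apply]
  have h := pderiv_reImPow hij n
  rw [happ, ← Finset.sum_subset (Finset.subset_univ {i, j}), Finset.sum_pair hij, h.1, h.2,
    map_neg, pderiv_pderiv_comm, add_neg_cancel]
  intro k _ hk
  simp only [Finset.mem_insert, Finset.mem_singleton, not_or] at hk
  rw [(pderiv_reImPow_of_ne (Ne.symm hk.1) (Ne.symm hk.2) n).1, map_zero]

theorem eval_single_reImPow {i j : Fin d} (hij : i ≠ j) (n : ℕ) :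
    eval (Pi.single i (1 : ℝ)) (reImPow i j n).1 = 1 := by
  induction n with
  | zero => simp [reImPow]
  | succ n ih => simp [reImPow, ih, hij.symm]

theorem finrank_harmonicHomogeneous_pos (hd : 2 ≤ d) (n : ℕ) :
    0 < Module.finrank ℝ (harmonicHomogeneous d n) := by
  have hij : (⟨0, by omega⟩ : Fin d) ≠ ⟨1, by omega⟩ := by simp
  have hfin : Module.Finite ℝ (harmonicHomogeneous d n) :=
    Submodule.finiteDimensional_of_le (inf_le_left : harmonicHomogeneous d n ≤ _)
  have hne : harmonicHomogeneous d n ≠ ⊥ := by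
    refine (Submodule.ne_bot_iff _).mpr ⟨_, ⟨(reImPow_isHomogeneous _ _ n).1,
      polyLaplacian_reImPow hij n⟩, fun h => ?_⟩
    simpa [h] using eval_single_reImPow hij n
  have := Submodule.nontrivial_iff_ne_bot.mpr hne
  exact Module.finrank_pos

end Harmonic

/-! ### Moments of strong Euclidean designs -/

section TensorMonomial

open MvPolynomial

variable {d : ℕ}

/-- The monomial `X_{f 0} ⋯ X_{f (k-1)}`. Each monomial of degree `k` occurs as often as its
multinomial coefficient says, so sums over `f` need no weights: `(a ⬝ b)^k` is the sum over all `f`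
of the products of the values at `a` and at `b`. -/
noncomputable def tensorMonomial {k : ℕ} (f : Fin k → Fin d) : MvPolynomial (Fin d) ℝ :=
  ∏ j, X (f j)

theorem eval_tensorMonomial {k : ℕ} (u : Fin d → ℝ) (f : Fin k → Fin d) :
    eval u (tensorMonomial f) = ∏ j, u (f j) := by
  simp [tensorMonomial, map_prod]

theorem mem_span_tensorMonomial {k : ℕ} {p : MvPolynomial (Fin d) ℝ} (hp : p.IsHomogeneous k) :
    p ∈ Submodule.span ℝ (Set.range (tensorMonomial : (Fin k → Fin d) → _)) := by
  rw [p.as_sum]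
  refine Submodule.sum_mem _ fun s hs => ?_
  have hdeg : s.toMultiset.card = k := by
    have := hp (mem_support_iff.mp hs)
    rw [Finsupp.weight_apply] at this
    simpa [Finsupp.card_toMultiset, Finsupp.sum] using this
  obtain ⟨l, hl⟩ := Quot.exists_rep s.toMultiset
  change (l : Multiset (Fin d)) = _ at hl
  obtain rfl : l.length = k := by rw [← hdeg, ← hl, Multiset.coe_card]
  have hmon : monomial s (p.coeff s) = p.coeff s • tensorMonomial fun j => l[j] := by
    have hprod : tensorMonomial (fun j : Fin l.length => l[j]) =
        (s.toMultiset.map (X : Fin d → MvPolynomial (Fin d) ℝ)).prod := by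
      rw [← hl, Multiset.map_coe, Multiset.prod_coe]
      exact Fin.prod_univ_fun_getElem l X
    rw [hprod, Finsupp.toMultiset_map, Finsupp.prod_toMultiset, Finsupp.prod_mapDomain_index
      (fun _ => pow_zero _) (fun _ _ _ => pow_add _ _ _), MvPolynomial.smul_eq_C_mul,
      monomial_eq]
  rw [hmon]
  exact Submodule.smul_mem _ _ (Submodule.subset_span ⟨_, rfl⟩)

theorem eval_neg_of_isHomogeneous {n : ℕ} {p : MvPolynomial (Fin d) ℝ} (hp : p.IsHomogeneous n)
    (u : Fin d → ℝ) : eval (-u) p = (-1) ^ n * eval u p := by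
  have hspan := mem_span_tensorMonomial hp
  clear hp
  induction hspan using Submodule.span_induction with
  | mem p h =>
    obtain ⟨f, rfl⟩ := h
    simp [eval_tensorMonomial, Finset.prod_neg]
  | zero => simp
  | add p q _ _ hp hq => rw [map_add, map_add, hp, hq, mul_add]
  | smul a p _ hp => rw [MvPolynomial.smul_eval, MvPolynomial.smul_eval, hp, mul_left_comm]

theorem sum_prod_mul_prod {A : Type*} [CommSemiring A] (a b : Fin d → A) (k : ℕ) :
    ∑ f : Fin k → Fin d, (∏ j, a (f j)) * ∏ j, b (f j) = (∑ i, a i * b i) ^ k := by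
  rw [Fintype.sum_pow]
  simp [Finset.prod_mul_distrib]

theorem linearForm_pow (a : Fin d → ℝ) (k : ℕ) :
    linearForm a ^ k = ∑ f : Fin k → Fin d, MvPolynomial.C (∏ j, a (f j)) * tensorMonomial f := by
  rw [linearForm, ← sum_prod_mul_prod]
  simp [tensorMonomial, map_prod]

theorem sum_prod_mul_gaussianExpectation (a : Fin d → ℝ) (k : ℕ) :
    ∑ f : Fin k → Fin d, (∏ j, a (f j)) * gaussianExpectation d (tensorMonomial f) =
      gaussianExpectation d (linearForm a ^ k) := by
  rw [linearForm_pow, map_sum]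
  simp only [gaussianExpectation_C_mul]

theorem tensorMonomial_isHomogeneous {k : ℕ} (f : Fin k → Fin d) :
    (tensorMonomial f).IsHomogeneous k := by
  simpa [tensorMonomial] using IsHomogeneous.prod Finset.univ
    (fun j => (X (f j) : MvPolynomial (Fin d) ℝ))
    (fun _ => 1) fun j _ => isHomogeneous_X ℝ (f j)

/-- Both sides are `𝔼 (x ⬝ y)^k` for two independent standard Gaussian vectors `x, y`. -/
theorem sum_gaussianExpectation_tensorMonomial_sq (k : ℕ) :
    ∑ f : Fin k → Fin d, gaussianExpectation d (tensorMonomial f) ^ 2 =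
      radialMoment d k * gaussianMoment k := by
  rcases Nat.even_or_odd' k with ⟨m, rfl | rfl⟩
  · have hpoly : ∑ f : Fin (2 * m) → Fin d,
        MvPolynomial.C (gaussianExpectation d (tensorMonomial f)) * tensorMonomial f =
          MvPolynomial.C (gaussianMoment (2 * m)) * normSqPoly d ^ m := by
      refine MvPolynomial.funext fun u => ?_
      simp only [map_sum, map_mul, MvPolynomial.eval_C, eval_tensorMonomial, map_pow, normSqPoly,
        MvPolynomial.eval_X]
      rw [mul_comm (gaussianMoment _), ← gaussianExpectation_linearForm_pow_even,
        ← sum_prod_mul_gaussianExpectation]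
      exact Finset.sum_congr rfl fun f _ => mul_comm _ _
    have h := congrArg (gaussianExpectation d) hpoly
    simp only [map_sum, gaussianExpectation_C_mul, gaussianExpectation_normSqPoly_pow] at h
    rw [mul_comm (radialMoment d (2 * m)), ← h]
    exact Finset.sum_congr rfl fun f _ => pow_two _
  · rw [gaussianMoment_odd, mul_zero]
    refine Finset.sum_eq_zero fun f _ => ?_
    rw [gaussianExpectation_eq_zero_of_odd ⟨m, rfl⟩ (tensorMonomial_isHomogeneous f), zero_pow
      two_ne_zero]

end TensorMonomial

section Moments

variable {d : ℕ}

/-- The vanishing of all Gegenbauer sums up to degree `t` determines the sums of powers of inner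
products, since `s ^ k` is a combination of Gegenbauer polynomials and all but the constant one
integrate to zero. -/
theorem sum_inner_pow_of_gegenbauer (hd : 2 ≤ d) {ι : Type*} (S : Finset ι) (c : ι → ℝ)
    (u : ι → Fin d → ℝ) {t : ℕ}
    (h : ∀ j, 1 ≤ j → j ≤ t →
      ∑ a ∈ S, ∑ b ∈ S, c a * c b * (gegenbauer d j).eval (∑ i, u a i * u b i) = 0)
    {k : ℕ} (hk : k ≤ t) :
    radialMoment d k * ∑ a ∈ S, ∑ b ∈ S, c a * c b * (∑ i, u a i * u b i) ^ k =
      (∑ a ∈ S, c a) ^ 2 * gaussianMoment k := by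
  set T : ℝ[X] → ℝ := fun p => ∑ a ∈ S, ∑ b ∈ S, c a * c b * p.eval (∑ i, u a i * u b i) with hT
  have hTadd (p q : ℝ[X]) : T (p + q) = T p + T q := by
    simp [hT, mul_add, Finset.sum_add_distrib]
  have hTC (r : ℝ) (p : ℝ[X]) : T (C r * p) = r * T p := by
    simp [hT, Finset.mul_sum, mul_left_comm]
  have hTsum {n : ℕ} (p : Fin n → ℝ[X]) : T (∑ j, p j) = ∑ j, T (p j) :=
    map_sum (AddMonoidHom.mk' T hTadd) _ _
  have hTone : T 1 = (∑ a ∈ S, c a) ^ 2 := by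
    simp [hT, pow_two, Finset.sum_mul_sum]
  have hmonic (j : ℕ) (hj : j ≤ t) : T (monicGegenbauer d j) * gegenbauerIntegral hd 1 =
      (∑ a ∈ S, c a) ^ 2 * gegenbauerIntegral hd (monicGegenbauer d j) := by
    rcases Nat.eq_zero_or_pos j with rfl | hj0
    · have h1 : monicGegenbauer d 0 = 1 := by
        rw [monicGegenbauer]
        simp
      rw [h1, hTone]
    · have h0 := h j hj0 hj
      have hne : (Module.finrank ℝ (harmonicHomogeneous d j) : ℝ) /
          (monicGegenbauer d j).eval 1 ≠ 0 :=
        div_ne_zero (by exact_mod_cast (finrank_harmonicHomogeneous_pos hd j).ne')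
          (monicGegenbauer_eval_one_ne_zero hd j)
      change T (gegenbauer d j) = 0 at h0
      rw [gegenbauer, hTC] at h0
      have hint := gegenbauerIntegral_monicGegenbauer_mul_of_natDegree_lt hd (n := j) (q := 1)
        (by simpa using hj0)
      rw [mul_one] at hint
      rw [(mul_eq_zero.mp h0).resolve_left hne, hint, zero_mul, mul_zero]
  have hpow : T (X ^ k) * gegenbauerIntegral hd 1 =
      (∑ a ∈ S, c a) ^ 2 * gegenbauerIntegral hd (X ^ k) := by
    obtain ⟨b, hb⟩ := X_pow_eq_monicGegenbauer_add d k
    rw [hb, hTadd, hTsum, map_add, map_sum, add_mul, mul_add, hmonic k hk, Finset.sum_mul,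
      Finset.mul_sum]
    congr 1
    refine Finset.sum_congr rfl fun j _ => ?_
    rw [hTC, gegenbauerIntegral_C_mul, mul_assoc, hmonic j (j.2.le.trans hk)]
    ring
  have hTX : T (X ^ k) = ∑ a ∈ S, ∑ b ∈ S, c a * c b * (∑ i, u a i * u b i) ^ k := by
    simp [hT]
  rw [← hTX]
  refine mul_right_cancel₀ (gegenbauerIntegral_one_pos hd).ne' ?_
  linear_combination radialMoment d k * hpow +
    (∑ a ∈ S, c a) ^ 2 * gegenbauerIntegral_X_pow hd k

/-- A weighted point set on the unit sphere whose Gegenbauer sums of degrees `1, …, t` vanish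
averages homogeneous polynomials of degree `k ≤ t` exactly; the average over the sphere is the
Gaussian expectation divided by the radial moment. -/
theorem sum_eval_of_gegenbauer (hd : 2 ≤ d) {ι : Type*} (S : Finset ι) (c : ι → ℝ)
    (u : ι → Fin d → ℝ) (hu : ∀ a ∈ S, ∑ i, u a i ^ 2 = 1) {t : ℕ}
    (h : ∀ j, 1 ≤ j → j ≤ t →
      ∑ a ∈ S, ∑ b ∈ S, c a * c b * (gegenbauer d j).eval (∑ i, u a i * u b i) = 0)
    {k : ℕ} (hk : k ≤ t) {p : MvPolynomial (Fin d) ℝ} (hp : p.IsHomogeneous k) :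
    radialMoment d k * ∑ a ∈ S, c a * MvPolynomial.eval (u a) p =
      (∑ a ∈ S, c a) * gaussianExpectation d p := by
  have hspan := mem_span_tensorMonomial hp
  clear hp
  induction hspan using Submodule.span_induction with
  | zero => simp
  | add p q _ _ hp hq =>
    simp only [map_add, mul_add, Finset.sum_add_distrib] at hp hq ⊢
    rw [hp, hq]
  | smul r p _ hp =>
    simp only [MvPolynomial.smul_eval, mul_left_comm (c _) r, map_smul, smul_eq_mul,
      ← Finset.mul_sum]
    rw [mul_left_comm, hp, mul_left_comm]
  | mem p h' =>
    obtain ⟨f, rfl⟩ := h'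
    set R := radialMoment d k
    set M := ∑ a ∈ S, c a with hM
    set A : (Fin k → Fin d) → ℝ := fun f => ∑ a ∈ S, c a * ∏ j, u a (f j) with hA
    set G : (Fin k → Fin d) → ℝ := fun f => gaussianExpectation d (tensorMonomial f) with hG
    have hAA : R * ∑ f, A f ^ 2 = M ^ 2 * gaussianMoment k := by
      rw [← sum_inner_pow_of_gegenbauer hd S c u h hk]
      congr 1
      simp only [hA, pow_two, Finset.sum_mul_sum]
      rw [Finset.sum_comm]
      refine Finset.sum_congr rfl fun a _ => ?_
      rw [Finset.sum_comm]
      refine Finset.sum_congr rfl fun b _ => ?_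
      rw [← sum_prod_mul_prod, Finset.mul_sum]
      exact Finset.sum_congr rfl fun f _ => by ring
    have hAG : ∑ f, A f * G f = M * gaussianMoment k := by
      simp only [hA, Finset.sum_mul]
      rw [Finset.sum_comm, hM, Finset.sum_mul]
      refine Finset.sum_congr rfl fun a ha => ?_
      rw [← gaussianExpectation_linearForm_pow (hu a ha), ← sum_prod_mul_gaussianExpectation,
        Finset.mul_sum]
      exact Finset.sum_congr rfl fun f _ => mul_assoc _ _ _
    have hGG : ∑ f, G f ^ 2 = R * gaussianMoment k := sum_gaussianExpectation_tensorMonomial_sq k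
    have hsq : ∑ f, (R * A f - M * G f) ^ 2 = 0 := by
      have hexp (f : Fin k → Fin d) : (R * A f - M * G f) ^ 2 =
          R ^ 2 * A f ^ 2 - 2 * R * M * (A f * G f) + M ^ 2 * G f ^ 2 := by ring
      simp only [hexp, Finset.sum_add_distrib, Finset.sum_sub_distrib, ← Finset.mul_sum]
      rw [hAG, hGG]
      linear_combination R * hAA
    have hzero := (Finset.sum_eq_zero_iff_of_nonneg fun f _ => sq_nonneg _).mp hsq f
      (Finset.mem_univ f)
    simp only [eval_tensorMonomial]
    exact sub_eq_zero.mp (pow_eq_zero_iff two_ne_zero |>.mp hzero)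

theorem sum_unitDir_sq {x : EuclideanSpace ℝ (Fin d)} (hx : x ≠ 0) :
    ∑ i, unitDir x i ^ 2 = 1 := by
  rw [← EuclideanSpace.real_norm_sq_eq, unitDir, norm_smul, norm_inv, norm_norm,
    inv_mul_cancel₀ (norm_ne_zero_iff.mpr hx), one_pow]

/-- For each exponent of the radius separately, a strong design averages homogeneous polynomials
in the direction `x'` exactly. -/
theorem IsStrongEuclideanDesign.sum_eval (hd : 2 ≤ d) {t : ℕ}
    {X : Finset (EuclideanSpace ℝ (Fin d))} {w : EuclideanSpace ℝ (Fin d) → ℝ}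
    (hX : IsStrongEuclideanDesign t X w) {i k : ℕ} (hi : i ≤ t) (hk : k ≤ t)
    {p : MvPolynomial (Fin d) ℝ} (hp : p.IsHomogeneous k) :
    radialMoment d k * ∑ x ∈ X, w x * ‖x‖ ^ i * MvPolynomial.eval (unitDir x).ofLp p =
      (∑ x ∈ X, w x * ‖x‖ ^ i) * gaussianExpectation d p := by
  refine sum_eval_of_gegenbauer hd X (fun x => w x * ‖x‖ ^ i) (fun x => (unitDir x).ofLp)
    (fun x hx => sum_unitDir_sq fun h => hX.zero_notMem (h ▸ hx)) (fun j hj hjt => ?_) hk hp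
  rw [← hX.sum_eq_zero i j hi hj hjt]
  refine Finset.sum_congr rfl fun x _ => Finset.sum_congr rfl fun y _ => ?_
  rw [PiLp.inner_apply, mul_pow]
  simp only [RCLike.inner_apply, conj_trivial]
  rw [Finset.sum_congr rfl fun i _ => mul_comm ((unitDir y).ofLp i) _]
  ring

end Moments

/-! ### The space of test functions -/

section TestFunctions

open MvPolynomial

variable {d n : ℕ}

/-- The polynomial `∑ rⁱ hᵢ`, whose values at unit vectors are those of the test function
`x ↦ ∑ ‖x‖ⁱ hᵢ(x')` on the sphere of radius `r`. -/
noncomputable def radialCombination (r : ℝ) (h : Fin n → MvPolynomial (Fin d) ℝ) :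
    MvPolynomial (Fin d) ℝ :=
  ∑ i : Fin n, r ^ (i : ℕ) • h i

theorem radialCombination_isHomogeneous (r : ℝ) {m : ℕ} {h : Fin n → MvPolynomial (Fin d) ℝ}
    (hh : ∀ i, (h i).IsHomogeneous m) : (radialCombination r h).IsHomogeneous m :=
  (homogeneousSubmodule (Fin d) ℝ m).sum_mem fun i _ =>
    (homogeneousSubmodule (Fin d) ℝ m).smul_mem _ (hh i)

theorem eq_zero_of_radialCombination_eq_zero {h : Fin n → MvPolynomial (Fin d) ℝ} (s : Finset ℝ)
    (hs : n ≤ s.card) (hzero : ∀ r ∈ s, radialCombination r h = 0) : h = 0 := by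
  funext i
  ext α
  have hcoeff (r : ℝ) : (∑ i : Fin n,
      Polynomial.C (coeff α (h i)) * Polynomial.X ^ (i : ℕ) : ℝ[X]).eval r =
        coeff α (radialCombination r h) := by
    simp only [radialCombination, Polynomial.eval_finsetSum, MvPolynomial.coeff_sum,
      Polynomial.eval_mul, Polynomial.eval_C, Polynomial.eval_pow, Polynomial.eval_X,
      MvPolynomial.coeff_smul, smul_eq_mul]
    exact Finset.sum_congr rfl fun i _ => mul_comm _ _
  have hdeg : (∑ i : Fin n, Polynomial.C (coeff α (h i)) * Polynomial.X ^ (i : ℕ) : ℝ[X]).degree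
      < n := by
    exact Polynomial.degree_sum_fin_lt fun i => coeff α (h i)
  have hpoly : (∑ i : Fin n, Polynomial.C (coeff α (h i)) * Polynomial.X ^ (i : ℕ) : ℝ[X]) = 0 :=
    Polynomial.eq_zero_of_degree_lt_of_eval_finset_eq_zero s
      (hdeg.trans_le (by exact_mod_cast hs)) fun r hr => by rw [hcoeff, hzero r hr,
        MvPolynomial.coeff_zero]
  have := congrArg (fun p : ℝ[X] => p.coeff i) hpoly
  simpa [Polynomial.finsetSum_coeff, Polynomial.coeff_X_pow, Fin.val_inj] using this

theorem gaussianExpectation_mul_self_nonneg (p : MvPolynomial (Fin d) ℝ) :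
    0 ≤ gaussianExpectation d (p * p) :=
  MeasureTheory.integral_nonneg fun x => by simpa using mul_self_nonneg (eval x p)

/-- A strong design averages products of test functions exactly in the angular variables. -/
theorem IsStrongEuclideanDesign.sum_eval_mul (hd : 2 ≤ d) {t e m n : ℕ}
    {X : Finset (EuclideanSpace ℝ (Fin d))} {w : EuclideanSpace ℝ (Fin d) → ℝ}
    (hX : IsStrongEuclideanDesign t X w) (het : 2 * e ≤ t) (hmn : m + n ≤ t)
    {h k : Fin (e + 1) → MvPolynomial (Fin d) ℝ} (hh : ∀ i, (h i).IsHomogeneous m)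
    (hk : ∀ i, (k i).IsHomogeneous n) :
    radialMoment d (m + n) * ∑ x ∈ X, w x * (eval (unitDir x).ofLp (radialCombination ‖x‖ h) *
        eval (unitDir x).ofLp (radialCombination ‖x‖ k)) =
      ∑ x ∈ X, w x *
        gaussianExpectation d (radialCombination ‖x‖ h * radialCombination ‖x‖ k) := by
  have hprod (x : EuclideanSpace ℝ (Fin d)) : radialCombination ‖x‖ h * radialCombination ‖x‖ k =
      ∑ i : Fin (e + 1), ∑ j : Fin (e + 1), ‖x‖ ^ ((i : ℕ) + j) • (h i * k j) := by
    simp only [radialCombination, Finset.sum_mul_sum, smul_mul_smul_comm, pow_add]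
  have hswap (L : EuclideanSpace ℝ (Fin d) → MvPolynomial (Fin d) ℝ →ₗ[ℝ] ℝ) :
      ∑ x ∈ X, w x * L x (radialCombination ‖x‖ h * radialCombination ‖x‖ k) =
        ∑ i : Fin (e + 1), ∑ j : Fin (e + 1), ∑ x ∈ X, w x * ‖x‖ ^ ((i : ℕ) + j) * L x (h i * k j) := by
    simp only [hprod, map_sum, map_smul, smul_eq_mul, Finset.mul_sum, mul_assoc]
    rw [Finset.sum_comm]
    exact Finset.sum_congr rfl fun i _ => Finset.sum_comm
  have hleft := hswap fun x => (MvPolynomial.aeval (unitDir x).ofLp).toLinearMap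
  simp only [AlgHom.toLinearMap_apply, MvPolynomial.aeval_eq_eval, map_mul] at hleft
  rw [hleft, hswap fun _ => gaussianExpectation d, Finset.mul_sum]
  refine Finset.sum_congr rfl fun i _ => ?_
  rw [Finset.mul_sum]
  refine Finset.sum_congr rfl fun j _ => ?_
  have := hX.sum_eval hd (i := i + j) (by omega) hmn ((hh i).mul (hk j))
  simp only [map_mul] at this
  rw [this, Finset.sum_mul]

/-- A test function of small angular degree whose weighted square sum over `X` vanishes is zero:
its mean square over each sphere of the design vanishes, and the number of spheres exceeds its
degree in the radius. -/
theorem IsStrongEuclideanDesign.eq_zero_of_sum_sq_nonpos (hd : 2 ≤ d) {t e m : ℕ}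
    {X : Finset (EuclideanSpace ℝ (Fin d))} {w : EuclideanSpace ℝ (Fin d) → ℝ}
    (hX : IsStrongEuclideanDesign t X w) (het : 2 * e ≤ t) (hm : m + m ≤ t)
    (hcard : e + 1 ≤ (radii X).card)
    {h : Fin (e + 1) → MvPolynomial (Fin d) ℝ} (hh : ∀ i, (h i).IsHomogeneous m)
    (hsum : ∑ x ∈ X, w x * eval (unitDir x).ofLp (radialCombination ‖x‖ h) ^ 2 ≤ 0) : h = 0 := by
  have hs := hX.sum_eval_mul hd het hm hh hh
  simp only [← pow_two (MvPolynomial.eval _ _)] at hs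
  have hnn (x) (hx : x ∈ X) : 0 ≤ w x *
      gaussianExpectation d (radialCombination ‖x‖ h * radialCombination ‖x‖ h) :=
    mul_nonneg (hX.weight_pos x hx).le (gaussianExpectation_mul_self_nonneg _)
  have h0 : ∑ x ∈ X, w x *
      gaussianExpectation d (radialCombination ‖x‖ h * radialCombination ‖x‖ h) = 0 :=
    le_antisymm (hs ▸ mul_nonpos_of_nonneg_of_nonpos (radialMoment_pos (by omega) _).le hsum)
      (Finset.sum_nonneg hnn)
  refine eq_zero_of_radialCombination_eq_zero (radii X) hcard fun r hr => ?_
  obtain ⟨x, hx, rfl⟩ := Finset.mem_image.mp hr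
  exact eq_zero_of_gaussianExpectation_mul_self
    ((mul_eq_zero.mp ((Finset.sum_eq_zero_iff_of_nonneg hnn).mp h0 x hx)).resolve_left
      (hX.weight_pos x hx).ne')

/-- The values on `Y` of the test functions `x ↦ ∑ ‖x‖ⁱ hᵢ(x')` with `hᵢ` homogeneous of
degree `m`. -/
noncomputable def evalTestFunction (e m : ℕ) (Y : Finset (EuclideanSpace ℝ (Fin d))) :
    (Fin (e + 1) → homogeneousSubmodule (Fin d) ℝ m) →ₗ[ℝ] (Y → ℝ) where
  toFun h y := eval (unitDir y.1).ofLp (radialCombination ‖y.1‖ fun i => (h i).1)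
  map_add' h k := by
    ext y
    simp [radialCombination, Finset.sum_add_distrib]
  map_smul' a h := by
    ext y
    simp [radialCombination, Finset.mul_sum, mul_left_comm]

theorem finrank_testFunction (e m : ℕ) :
    Module.finrank ℝ (Fin (e + 1) → homogeneousSubmodule (Fin d) ℝ m) =
      (e + 1) * (d + m - 1).choose m := by
  simp [Module.finrank_pi_fintype, (homogeneousSubmodule_finite_finrank d m).2]

theorem IsStrongEuclideanDesign.card_ge (hd : 2 ≤ d) {e : ℕ}
    {X : Finset (EuclideanSpace ℝ (Fin d))} {w : EuclideanSpace ℝ (Fin d) → ℝ}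
    (hX : IsStrongEuclideanDesign (2 * (e + 1)) X w) (hcard : e + 1 + 1 ≤ (radii X).card) :
    (e + 1 + 1) * ((d + (e + 1) - 1).choose (e + 1) + (d + e - 1).choose e) ≤ X.card := by
  have hinj : Function.Injective
      ((evalTestFunction (d := d) (e + 1) (e + 1) X).coprod (evalTestFunction (e + 1) e X)) := by
    rw [injective_iff_map_eq_zero]
    rintro ⟨h, k⟩ hhk
    have hval (x) (hx : x ∈ X) :
        eval (unitDir x).ofLp (radialCombination ‖x‖ fun i => (h i).1) +
          eval (unitDir x).ofLp (radialCombination ‖x‖ fun i => (k i).1) = 0 :=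
      congrFun hhk ⟨x, hx⟩
    have hcross : ∑ x ∈ X, w x *
        (eval (unitDir x).ofLp (radialCombination ‖x‖ fun i => (h i).1) *
          eval (unitDir x).ofLp (radialCombination ‖x‖ fun i => (k i).1)) = 0 := by
      -- The products have odd degree `2e + 1`, so their averages vanish.
      have := hX.sum_eval_mul hd (e := e + 1) le_rfl (by omega) (fun i => (h i).2) (fun i => (k i).2)
      rw [Finset.sum_eq_zero (s := X) (f := fun x => w x * gaussianExpectation d _)] at this
      · exact (mul_eq_zero.mp this).resolve_left (radialMoment_pos (by omega) _).ne'
      · intro x _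
        rw [gaussianExpectation_eq_zero_of_odd (n := e + 1 + e) ⟨e, by ring⟩
          ((radialCombination_isHomogeneous _ fun i => (h i).2).mul
            (radialCombination_isHomogeneous _ fun i => (k i).2)), mul_zero]
    -- The sum of the two test functions vanishes on `X`, so the square of either is minus their
    -- product there.
    have hh : (fun i => (h i).1) = 0 := by
      refine hX.eq_zero_of_sum_sq_nonpos hd le_rfl (by omega) hcard (fun i => (h i).2)
        (le_of_eq ?_)
      rw [← neg_zero, ← hcross, ← Finset.sum_neg_distrib]
      refine Finset.sum_congr rfl fun x hx => ?_
      rw [eq_neg_of_add_eq_zero_left (hval x hx)]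
      ring
    have hk : (fun i => (k i).1) = 0 := by
      refine hX.eq_zero_of_sum_sq_nonpos hd le_rfl (by omega) hcard (fun i => (k i).2)
        (le_of_eq ?_)
      rw [← neg_zero, ← hcross, ← Finset.sum_neg_distrib]
      refine Finset.sum_congr rfl fun x hx => ?_
      rw [eq_neg_of_add_eq_zero_left (hval x hx)]
      ring
    exact Prod.ext (funext fun i => Subtype.ext (congrFun hh i))
      (funext fun i => Subtype.ext (congrFun hk i))
  have h := LinearMap.finrank_le_finrank_of_injective hinj
  rw [Module.finrank_prod, finrank_testFunction, finrank_testFunction, ← mul_add] at h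
  simpa using h

/-- An antipodal set not containing the origin is covered by a set of at most half its size
together with the negatives of that set. -/
theorem exists_half_of_antipodal {E : Type*} [AddGroup E] [IsAddTorsionFree E]
    {X : Finset E} (h0 : (0 : E) ∉ X) (hneg : ∀ x, x ∈ X ↔ -x ∈ X) :
    ∃ Y : Finset E, 2 * Y.card ≤ X.card ∧ ∀ x ∈ X, x ∈ Y ∨ -x ∈ Y := by
  classical
  set Y := X.filter fun x => WellOrderingRel x (-x) with hY
  refine ⟨Y, ?_, fun x hx => ?_⟩
  · have hdisj : Disjoint Y (Y.image Neg.neg) := by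
      refine Finset.disjoint_left.mpr fun x hx hx' => ?_
      obtain ⟨y, hy, rfl⟩ := Finset.mem_image.mp hx'
      have h1 := (Finset.mem_filter.mp hx).2
      rw [neg_neg] at h1
      exact asymm h1 (Finset.mem_filter.mp hy).2
    rw [two_mul]
    nth_rewrite 2 [← Finset.card_image_of_injective Y neg_injective]
    rw [← Finset.card_union_of_disjoint hdisj]
    refine Finset.card_le_card (Finset.union_subset (Finset.filter_subset _ _) ?_)
    intro x hx
    obtain ⟨y, hy, rfl⟩ := Finset.mem_image.mp hx
    exact (hneg y).mp (Finset.mem_filter.mp hy).1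
  · have hne : x ≠ -x := fun h => h0 ((self_eq_neg.mp h) ▸ hx)
    rcases trichotomous_of WellOrderingRel x (-x) with h | h | h
    · exact Or.inl (Finset.mem_filter.mpr ⟨hx, h⟩)
    · exact absurd h hne
    · exact Or.inr (Finset.mem_filter.mpr ⟨(hneg x).mp hx, by rwa [neg_neg]⟩)

theorem IsStrongEuclideanDesign.card_ge_of_antipodal (hd : 2 ≤ d) {e : ℕ}
    {X : Finset (EuclideanSpace ℝ (Fin d))} {w : EuclideanSpace ℝ (Fin d) → ℝ}
    (hX : IsStrongEuclideanDesign (2 * e + 1) X w) (hneg : ∀ x, x ∈ X ↔ -x ∈ X)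
    (hcard : e + 1 ≤ (radii X).card) :
    2 * (e + 1) * (d + e - 1).choose e ≤ X.card := by
  have := IsAddTorsionFree.of_isTorsionFree ℝ (EuclideanSpace ℝ (Fin d))
  obtain ⟨Y, hYcard, hY⟩ := exists_half_of_antipodal hX.zero_notMem hneg
  have hinj : Function.Injective (evalTestFunction (d := d) e e Y) := by
    rw [injective_iff_map_eq_zero]
    intro h hzero
    have hvalY (y) (hy : y ∈ Y) :
        eval (unitDir y).ofLp (radialCombination ‖y‖ fun i => (h i).1) = 0 :=
      congrFun hzero ⟨y, hy⟩
    have hval (x) (hx : x ∈ X) :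
        eval (unitDir x).ofLp (radialCombination ‖x‖ fun i => (h i).1) = 0 := by
      rcases hY x hx with hxY | hxY
      · exact hvalY x hxY
      · have := hvalY (-x) hxY
        have hu : (unitDir (-x)).ofLp = -(unitDir x).ofLp := by simp [unitDir]
        rw [hu, norm_neg, eval_neg_of_isHomogeneous
          (radialCombination_isHomogeneous _ fun i => (h i).2)] at this
        exact (mul_eq_zero.mp this).resolve_left (pow_ne_zero _ (by norm_num))
    have hh : (fun i => (h i).1) = 0 := by
      refine hX.eq_zero_of_sum_sq_nonpos hd (by omega) (by omega) hcard (fun i => (h i).2)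
        (le_of_eq (Finset.sum_eq_zero fun x hx => ?_))
      rw [hval x hx, zero_pow two_ne_zero, mul_zero]
    exact funext fun i => Subtype.ext (congrFun hh i)
  have h := LinearMap.finrank_le_finrank_of_injective hinj
  rw [finrank_testFunction] at h
  simp only [Module.finrank_fintype_fun_eq_card, Fintype.card_coe] at h
  rw [mul_assoc]
  omega

end TestFunctions

/-! ### The bound for strong designs -/

/-- For `e = 0` the binomial coefficient `C(d+e-2, e-1) = C(d-2, -1)` is `0`. -/
theorem theorem1p4 (d p e t : ℕ) (hd : 2 ≤ d)
    (X : Finset (EuclideanSpace ℝ (Fin d))) (w : EuclideanSpace ℝ (Fin d) → ℝ)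
    (hX : IsStrongEuclideanDesign t X w) (hp : (radii X).card = p) (hpe : e + 1 ≤ p) :
    (t = 2 * e →
      (e + 1) * ((d + e - 1).choose e + if e = 0 then 0 else (d + e - 2).choose (e - 1))
        ≤ X.card) ∧
    (IsAntipodal X w → t = 2 * e + 1 →
      2 * (e + 1) * (d + e - 1).choose e ≤ X.card) := by
  subst hp
  refine ⟨?_, ?_⟩
  · rintro rfl
    rcases e with _ | e
    · simpa using hpe.trans Finset.card_image_le
    · rw [if_neg e.succ_ne_zero, show d + (e + 1) - 2 = d + e - 1 by omega]
      exact hX.card_ge hd hpe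
  · rintro hanti rfl
    exact hX.card_ge_of_antipodal hd hanti.1 hpe
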